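/- Theorem (tree-width duality; Seymour and Thomas). Let $G=(V,E)$ be a finite graph. A tree-decomposition of $G$ is a finite tree $T$ together with a label (bag) $l(t)\subseteq V$ for each node $t$, such that (i) $V=\bigcup_{t\in V(T)}l(t)$; (ii) every edge of $G$ is contained in at least one bag; (iii) for every $v\in V$, the nodes of $T$ whose bags contain $v$ induce a connected subtree of $T$. Its width is $\max_{t\in V(T)}|l(t)|-1$, and the tree-width $\mathrm{tw}(G)$ is the least width of a tree-decomposition of $G$. Two subsets of $V$ touch if they meet or if some edge of $G$ links them. A bramble in $G$ is a set $\mathcal B$ of mutually touching (nonempty) connected vertex sets of $G$. A cover of $\mathcal B$ is a set of vertices that meets every element of $\mathcal B$, and the order of $\mathcal B$ is the least size of a cover of $\mathcal B$. Then for every integer $k\ge 0$, $\mathrm{tw}(G)\ge k$ if and only if $G$ contains a bramble of order $>k$. Equivalently, the largest order of a bramble in $G$ exists and equals $\mathrm{tw}(G)+1$. -/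

import Mathlib

universe u

namespace SimpleGraph

/-- A tree-decomposition of a graph `G`: a finite tree whose nodes are labelled by finite sets of
vertices (bags). Every finite tree has a copy with node set in the universe of `V`, so the choice
of that universe loses nothing. -/
structure TreeDecomposition {V : Type u} (G : SimpleGraph V) where
  /-- the nodes of the tree -/
  node : Type u
  fintypeNode : Fintype node
  /-- the tree -/
  tree : SimpleGraph node
  isTree : tree.IsTree
  /-- the bag of a node -/
  bag : node → Finset V
  exists_mem_bag : ∀ v : V, ∃ t : node, v ∈ bag t
  exists_edge_bag : ∀ v w : V, G.Adj v w → ∃ t : node, v ∈ bag t ∧ w ∈ bag t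
  connected_nodes : ∀ v : V, (tree.induce {t : node | v ∈ bag t}).Connected

attribute [instance] TreeDecomposition.fintypeNode

/-- The width: the largest size of a bag, minus one. It is an integer, since the decomposition of
the graph without vertices has width `-1`. -/
def TreeDecomposition.width {V : Type u} {G : SimpleGraph V} (D : G.TreeDecomposition) : ℤ :=
  ((Finset.univ.sup fun t : D.node => (D.bag t).card : ℕ) : ℤ) - 1

/-- The tree-width: the least width of a tree-decomposition. -/
noncomputable def treewidth {V : Type u} (G : SimpleGraph V) : ℤ :=
  sInf {w : ℤ | ∃ D : G.TreeDecomposition, D.width = w}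

/-- Two sets of vertices touch if they meet or some edge links them. -/
def Touch {V : Type u} (G : SimpleGraph V) (X Y : Set V) : Prop :=
  (X ∩ Y).Nonempty ∨ ∃ x ∈ X, ∃ y ∈ Y, G.Adj x y

/-- A bramble: a set of mutually touching connected (in particular nonempty) vertex sets. -/
def IsBramble {V : Type u} (G : SimpleGraph V) (B : Set (Set V)) : Prop :=
  (∀ X ∈ B, (G.induce X).Connected) ∧ ∀ X ∈ B, ∀ Y ∈ B, G.Touch X Y

end SimpleGraph

/-- A cover of a family of vertex sets: a set of vertices that meets all its elements. -/
def IsBrambleCover {V : Type u} (B : Set (Set V)) (S : Finset V) : Prop :=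
  ∀ X ∈ B, ∃ v ∈ S, v ∈ X

/-- The order: the least size of a cover. -/
noncomputable def brambleOrder {V : Type u} (B : Set (Set V)) : ℕ :=
  sInf {n : ℕ | ∃ S : Finset V, IsBrambleCover B S ∧ S.card = n}

namespace SimpleGraph

/-- On a finite graph the least width exists. -/
theorem isLeast_treewidth {V : Type u} [Finite V] (G : SimpleGraph V) :
    IsLeast {w : ℤ | ∃ D : G.TreeDecomposition, D.width = w} G.treewidth := by
  have hb : BddBelow {w : ℤ | ∃ D : G.TreeDecomposition, D.width = w} := by
    refine ⟨-1, ?_⟩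
    rintro w ⟨D, rfl⟩
    unfold TreeDecomposition.width
    omega
  have hne : {w : ℤ | ∃ D : G.TreeDecomposition, D.width = w}.Nonempty := by
    haveI := Fintype.ofFinite V
    refine ⟨_, ⟨PUnit, inferInstance, ⊥, IsTree.of_subsingleton, fun _ => Finset.univ,
      fun v => ⟨PUnit.unit, Finset.mem_univ v⟩,
      fun v w _ => ⟨PUnit.unit, Finset.mem_univ v, Finset.mem_univ w⟩, fun v => ?_⟩, rfl⟩
    haveI : Nonempty {t : PUnit | v ∈ (Finset.univ : Finset V)} :=
      ⟨⟨PUnit.unit, Finset.mem_univ v⟩⟩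
    exact (IsTree.of_subsingleton).connected
  exact ⟨Int.csInf_mem hne hb, fun w hw => csInf_le hb hw⟩

/-- On a finite graph every bramble has a cover, and the least size of a cover exists. -/
theorem IsBramble.isLeast_order {V : Type u} [Finite V] {G : SimpleGraph V} {B : Set (Set V)}
    (hB : G.IsBramble B) :
    IsLeast {n : ℕ | ∃ S : Finset V, IsBrambleCover B S ∧ S.card = n} (brambleOrder B) := by
  haveI := Fintype.ofFinite V
  have hne : {n : ℕ | ∃ S : Finset V, IsBrambleCover B S ∧ S.card = n}.Nonempty := by
    refine ⟨_, Finset.univ, fun X hX => ?_, rfl⟩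
    obtain ⟨v⟩ := (hB.1 X hX).nonempty
    exact ⟨v.1, Finset.mem_univ _, v.2⟩
  exact ⟨Nat.sInf_mem hne, fun n hn => Nat.sInf_le hn⟩

end SimpleGraph

/-! Some bag of every tree-decomposition covers a given bramble
(`TreeDecomposition.exists_bag_isBrambleCover`), so no order exceeds `tw(G) + 1`. Otherwise each
node points along an edge towards the bags meeting a bramble element that its own bag misses. There
are fewer edges than nodes, so two nodes point at each other along one edge; their two elements
touch, hence meet a common bag, which would lie on both sides of that edge.

Conversely, suppose that every bramble has a cover of at most `k` vertices. Every bramble `B` then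
has a decomposition in which no bag of more than `k` vertices covers it
(`IsBramble.exists_admissible_treeDecomposition`), and `B = ∅`, covered by every set, gives width
less than `k`. The induction goes from larger brambles to smaller ones. Take a minimum cover `X` of
`B`; it suffices to decompose `G[X ∪ C]` for each component `C` of `G - X`, with `X` inside a bag,
and to glue along `X`. If `C` fails to touch some element of `B`, two bags suffice. Otherwise `B ∪
{C}` is a larger bramble, and its decomposition either serves `B` already or can be restricted to `X
∪ C` and rerouted so that a bag contains `X`
(`TreeDecomposition.hasTreeDecompositionOn_of_bag_disjoint`). Minimality of `X` keeps the bags from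
growing. -/

namespace SimpleGraph

/-! ### Connected vertex sets and joined trees -/

theorem connected_induce_iff_exists_walk {V : Type*} {G : SimpleGraph V} {S : Set V} :
    (G.induce S).Connected ↔
      S.Nonempty ∧ ∀ u ∈ S, ∀ v ∈ S, ∃ p : G.Walk u v, ∀ w ∈ p.support, w ∈ S := by
  constructor
  · intro h
    obtain ⟨x⟩ := h.nonempty
    refine ⟨⟨x.1, x.2⟩, fun u hu v hv => ?_⟩
    obtain ⟨p⟩ := h.preconnected ⟨u, hu⟩ ⟨v, hv⟩
    refine ⟨p.map (Embedding.induce S).toHom, fun w hw => ?_⟩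
    obtain ⟨z, -, rfl⟩ := List.mem_map.1 (Walk.support_map _ p ▸ hw)
    exact z.2
  · rintro ⟨⟨x, hx⟩, h⟩
    have : Nonempty S := ⟨⟨x, hx⟩⟩
    refine ⟨fun u v => ?_⟩
    obtain ⟨p, hp⟩ := h u.1 u.2 v.1 v.2
    exact ⟨p.induce S hp⟩

theorem Connected.induce_image {V W : Type*} {G : SimpleGraph V} {H : SimpleGraph W} (f : G →g H)
    {S : Set V} (hS : (G.induce S).Connected) : (H.induce (f '' S)).Connected := by
  rw [connected_induce_iff_exists_walk] at hS ⊢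
  refine ⟨hS.1.image f, ?_⟩
  rintro _ ⟨u, hu, rfl⟩ _ ⟨v, hv, rfl⟩
  obtain ⟨p, hp⟩ := hS.2 u hu v hv
  refine ⟨p.map f, fun w hw => ?_⟩
  rw [Walk.support_map, List.mem_map] at hw
  obtain ⟨z, hz, rfl⟩ := hw
  exact ⟨z, hp z hz, rfl⟩

/-- Two finite trees joined by an edge form a tree. -/
theorem IsTree.sum_sup_edge {M N : Type*} [Finite M] [Finite N] {S : SimpleGraph M}
    {T : SimpleGraph N} (hS : S.IsTree) (hT : T.IsTree) (m : M) (n : N) :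
    ((S ⊕g T) ⊔ edge (.inl m) (.inr n)).IsTree := by
  have hc := hS.connected.sum_sup_edge (v := m) (w := n) hT.connected
  -- Connectedness already forces enough edges; only the upper bound on their number remains.
  refine isTree_iff_connected_and_card.2 ⟨hc, le_antisymm ?_ hc.card_vert_le_card_edgeSet_add_one⟩
  have hsub : ((S ⊕g T) ⊔ edge (.inl m) (.inr n)).edgeSet ⊆
      (Sym2.map .inl '' S.edgeSet ∪ Sym2.map .inr '' T.edgeSet) ∪ {s(.inl m, .inr n)} := by
    intro e he
    induction e with | _ a b
    rw [mem_edgeSet, sup_adj] at he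
    rcases he with he | he
    · left
      rcases a with a | a <;> rcases b with b | b
      · exact Or.inl ⟨s(a, b), by simpa using he, rfl⟩
      · simp at he
      · simp at he
      · exact Or.inr ⟨s(a, b), by simpa using he, rfl⟩
    · right
      rw [edge_adj] at he
      rcases he.1 with ⟨rfl, rfl⟩ | ⟨rfl, rfl⟩
      · rfl
      · exact Sym2.eq_swap
  have h1 := Set.ncard_le_ncard hsub (Set.toFinite _)
  have h2 := Set.ncard_union_le (Sym2.map .inl '' S.edgeSet ∪ Sym2.map .inr '' T.edgeSet)
    {(s(.inl m, .inr n) : Sym2 (M ⊕ N))}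
  have h3 := Set.ncard_union_le (Sym2.map .inl '' S.edgeSet : Set (Sym2 (M ⊕ N)))
    (Sym2.map .inr '' T.edgeSet)
  have h4 := Set.ncard_image_le (f := Sym2.map (.inl : M → M ⊕ N)) (Set.toFinite S.edgeSet)
  have h5 := Set.ncard_image_le (f := Sym2.map (.inr : N → M ⊕ N)) (Set.toFinite T.edgeSet)
  have h6 := (isTree_iff_connected_and_card.1 hS).2
  have h7 := (isTree_iff_connected_and_card.1 hT).2
  rw [Nat.card_sum]
  rw [Set.ncard_singleton] at h2
  simp only [Nat.card_coe_set_eq] at *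
  omega

/-! ### Brambles are covered by bags -/

/-- A walk of `G` lifts to a walk in the tree along bags that meet it. -/
theorem TreeDecomposition.exists_walk_of_walk {V : Type u} {G : SimpleGraph V}
    (D : G.TreeDecomposition) {v w : V} (p : G.Walk v w) {a b : D.node} (ha : v ∈ D.bag a)
    (hb : w ∈ D.bag b) :
    ∃ q : D.tree.Walk a b, ∀ t ∈ q.support, ∃ u ∈ p.support, u ∈ D.bag t := by
  induction p generalizing a with
  | nil =>
    obtain ⟨q, hq⟩ := (connected_induce_iff_exists_walk.1 (D.connected_nodes _)).2 a ha b hb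
    exact ⟨q, fun t ht => ⟨_, Walk.start_mem_support _, hq t ht⟩⟩
  | @cons x y z hxy p ih =>
    obtain ⟨c, hxc, hyc⟩ := D.exists_edge_bag x y hxy
    obtain ⟨q, hq⟩ := (connected_induce_iff_exists_walk.1 (D.connected_nodes x)).2 a ha c hxc
    obtain ⟨r, hr⟩ := ih hyc hb
    refine ⟨q.append r, fun t ht => ?_⟩
    rcases (Walk.mem_support_append_iff _ _).1 ht with ht | ht
    · exact ⟨x, Walk.start_mem_support _, hq t ht⟩
    · obtain ⟨u, hu, hut⟩ := hr t ht
      exact ⟨u, by simp [hu], hut⟩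

/-- Every bramble is covered by some bag. -/
theorem TreeDecomposition.exists_bag_isBrambleCover {V : Type u} {G : SimpleGraph V}
    (D : G.TreeDecomposition) {B : Set (Set V)} (hB : G.IsBramble B) :
    ∃ t, IsBrambleCover B (D.bag t) := by
  classical
  by_contra! hno
  simp only [IsBrambleCover, not_forall, not_exists, not_and] at hno
  choose X hXB hX using hno
  -- each node `t` has a neighbour `f t` towards the bags that meet `X t`
  have hdir : ∀ t, ∃ t', D.tree.Adj t t' ∧
      ∀ r, (∃ v ∈ X t, v ∈ D.bag r) → ∃ p : D.tree.Walk t' r, t ∉ p.support := by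
    intro t
    obtain ⟨⟨x, hx⟩, hconn⟩ := connected_induce_iff_exists_walk.1 (hB.1 _ (hXB t))
    obtain ⟨r₀, hr₀⟩ := D.exists_mem_bag x
    obtain ⟨p, hp, -⟩ := D.isTree.existsUnique_path t r₀
    cases p with
    | nil => exact absurd hx (hX t x hr₀)
    | @cons _ t' _ h p =>
      refine ⟨t', h, ?_⟩
      rintro r ⟨v, hv, hvr⟩
      obtain ⟨q, hq⟩ := hconn x hx v hv
      obtain ⟨q', hq'⟩ := D.exists_walk_of_walk q hr₀ hvr
      refine ⟨p.append q', fun ht => ?_⟩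
      rcases (Walk.mem_support_append_iff _ _).1 ht with ht | ht
      · exact ((Walk.cons_isPath_iff _ _).1 hp).2 ht
      · obtain ⟨u, hu, hut⟩ := hq' t ht
        exact hX t u hut (hq u hu)
  choose f hadj hf using hdir
  have hcard := D.isTree.card_edgeFinset
  -- The tree has one edge fewer than nodes, so the edges `s(t, f t)` repeat.
  obtain ⟨t, -, t', -, hne, heq⟩ := Finset.exists_ne_map_eq_of_card_lt_of_maps_to
    (s := (Finset.univ : Finset D.node)) (t := D.tree.edgeFinset) (f := fun t => s(t, f t))
    (by rw [Finset.card_univ]; omega) (fun t _ => by simpa using hadj t)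
  have heq : t = f t' ∧ f t = t' := by
    rcases Sym2.eq_iff.1 heq with h | h
    · exact absurd h.1 hne
    · exact h
  obtain ⟨r, h1, h2⟩ : ∃ r, (∃ v ∈ X t, v ∈ D.bag r) ∧ ∃ v ∈ X t', v ∈ D.bag r := by
    rcases hB.2 _ (hXB t) _ (hXB t') with ⟨v, hv, hv'⟩ | ⟨v, hv, w, hw, hvw⟩
    · obtain ⟨r, hr⟩ := D.exists_mem_bag v
      exact ⟨r, ⟨v, hv, hr⟩, v, hv', hr⟩
    · obtain ⟨r, hr, hr'⟩ := D.exists_edge_bag v w hvw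
      exact ⟨r, ⟨v, hv, hr⟩, w, hw, hr'⟩
  obtain ⟨p, hp⟩ := hf t r h1
  obtain ⟨q, hq⟩ := hf t' r h2
  -- The edge between `t` and `t'` is a bridge, but `q` from `t` to `r` avoids `t'`, and `p` from
  -- `t'` to `r` avoids `t`.
  have hbr := isBridge_iff_forall_walk_mem_edges.1
    (isAcyclic_iff_forall_adj_isBridge.1 D.isTree.isAcyclic (hadj t))
    (q.copy heq.1.symm rfl |>.append p.reverse)
  rw [Walk.edges_append, List.mem_append, Walk.edges_copy, Walk.edges_reverse,
    List.mem_reverse] at hbr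
  rcases hbr with hbr | hbr
  · exact hq (heq.2 ▸ Walk.snd_mem_support_of_mem_edges _ hbr)
  · exact hp (Walk.fst_mem_support_of_mem_edges _ hbr)

/-! ### Decompositions of induced subgraphs and their gluing -/

/-- The tree `T` with the bags `bag` is a tree-decomposition of the subgraph induced on `U`. -/
structure IsTreeDecompositionOn {V : Type u} (G : SimpleGraph V) (U : Set V) {N : Type u}
    (T : SimpleGraph N) (bag : N → Finset V) : Prop where
  isTree : T.IsTree
  bag_subset : ∀ t, ∀ v ∈ bag t, v ∈ U
  exists_mem_bag : ∀ v ∈ U, ∃ t, v ∈ bag t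
  exists_edge_bag : ∀ v ∈ U, ∀ w ∈ U, G.Adj v w → ∃ t, v ∈ bag t ∧ w ∈ bag t
  connected_nodes : ∀ v ∈ U, (T.induce {t | v ∈ bag t}).Connected

/-- The subgraph induced on `U` has a tree-decomposition whose bags all satisfy `Q`, one of them
containing `X`. -/
def HasTreeDecompositionOn {V : Type u} (G : SimpleGraph V) (Q : Finset V → Prop)
    (U X : Set V) : Prop :=
  ∃ (N : Type u) (_ : Finite N) (T : SimpleGraph N) (bag : N → Finset V),
    G.IsTreeDecompositionOn U T bag ∧ (∀ t, Q (bag t)) ∧ ∃ s, ∀ x ∈ X, x ∈ bag s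

variable {V : Type u} {G : SimpleGraph V} {Q : Finset V → Prop}

theorem HasTreeDecompositionOn.of_bag {S : Finset V} (hS : Q S) :
    G.HasTreeDecompositionOn Q S S := by
  refine ⟨PUnit, inferInstance, ⊥, fun _ => S, ⟨IsTree.of_subsingleton, fun _ _ h => h,
    fun v hv => ⟨⟨⟩, hv⟩, fun v hv w hw _ => ⟨⟨⟩, hv, hw⟩, fun v hv => ?_⟩, fun _ => hS, ⟨⟩,
    fun _ h => h⟩
  have : Nonempty {t : PUnit | v ∈ S} := ⟨⟨⟨⟩, hv⟩⟩
  exact IsTree.of_subsingleton.connected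

/-- Join the two trees by an edge between the nodes whose bags contain `X₁` and `X₂`. A common
vertex lies in both of these bags, so the new edge links its two subtrees; no edge of `G` crosses
from `U₁ \ U₂` to `U₂ \ U₁`, so none is missed. -/
theorem HasTreeDecompositionOn.union {U₁ U₂ X₁ X₂ : Set V}
    (h₁ : G.HasTreeDecompositionOn Q U₁ X₁) (h₂ : G.HasTreeDecompositionOn Q U₂ X₂)
    (hX₁ : U₁ ∩ U₂ ⊆ X₁) (hX₂ : U₁ ∩ U₂ ⊆ X₂)
    (hadj : ∀ v ∈ U₁, ∀ w ∈ U₂, G.Adj v w → v ∈ U₂ ∨ w ∈ U₁) :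
    G.HasTreeDecompositionOn Q (U₁ ∪ U₂) X₁ := by
  obtain ⟨M, _, S, b, hS, hb, m, hm⟩ := h₁
  obtain ⟨N, _, T, c, hT, hc, n, hn⟩ := h₂
  refine ⟨M ⊕ N, inferInstance, (S ⊕g T) ⊔ edge (.inl m) (.inr n), Sum.elim b c,
    ⟨hS.isTree.sum_sup_edge hT.isTree m n, ?_, ?_, ?_, ?_⟩, ?_, .inl m, hm⟩
  · rintro (t | t) v hv
    · exact Or.inl (hS.bag_subset t v hv)
    · exact Or.inr (hT.bag_subset t v hv)
  · rintro v (hv | hv)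
    · obtain ⟨t, ht⟩ := hS.exists_mem_bag v hv
      exact ⟨.inl t, ht⟩
    · obtain ⟨t, ht⟩ := hT.exists_mem_bag v hv
      exact ⟨.inr t, ht⟩
  · have hl : ∀ v ∈ U₁, ∀ w ∈ U₁, G.Adj v w →
        ∃ t, v ∈ Sum.elim b c t ∧ w ∈ Sum.elim b c t := fun v hv w hw h => by
      obtain ⟨t, ht⟩ := hS.exists_edge_bag v hv w hw h
      exact ⟨.inl t, ht⟩
    have hr : ∀ v ∈ U₂, ∀ w ∈ U₂, G.Adj v w →
        ∃ t, v ∈ Sum.elim b c t ∧ w ∈ Sum.elim b c t := fun v hv w hw h => by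
      obtain ⟨t, ht⟩ := hT.exists_edge_bag v hv w hw h
      exact ⟨.inr t, ht⟩
    rintro v (hv | hv) w (hw | hw) h
    · exact hl v hv w hw h
    · exact (hadj v hv w hw h).elim (fun hv => hr v hv w hw h) (fun hw => hl v hv w hw h)
    · exact (hadj w hw v hv h.symm).elim (fun hw => hr v hv w hw h) (fun hv => hl v hv w hw h)
    · exact hr v hv w hw h
  · intro v hv
    have heq : {t | v ∈ Sum.elim b c t} = Sum.inl '' {t | v ∈ b t} ∪ Sum.inr '' {t | v ∈ c t} := by
      ext (t | t) <;> simp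
    let f : S →g (S ⊕g T) ⊔ edge (.inl m) (.inr n) := ⟨Sum.inl, fun h => Or.inl h⟩
    let g : T →g (S ⊕g T) ⊔ edge (.inl m) (.inr n) := ⟨Sum.inr, fun h => Or.inl h⟩
    have hf := fun hv => (hS.connected_nodes v hv).induce_image f
    have hg := fun hv => (hT.connected_nodes v hv).induce_image g
    rw [heq]
    by_cases h1 : v ∈ U₁ <;> by_cases h2 : v ∈ U₂
    · exact connected_induce_union (v := .inl m) (w := .inr n) (hf h1).preconnected
        (hg h2).preconnected ⟨m, hm v (hX₁ ⟨h1, h2⟩), rfl⟩ ⟨n, hn v (hX₂ ⟨h1, h2⟩), rfl⟩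
        (Or.inr (by simp [edge_adj]))
    · have : {t | v ∈ c t} = ∅ :=
        Set.eq_empty_of_forall_notMem fun t ht => h2 (hT.bag_subset t v ht)
      rw [this, Set.image_empty, Set.union_empty]
      exact hf h1
    · have : {t | v ∈ b t} = ∅ :=
        Set.eq_empty_of_forall_notMem fun t ht => h1 (hS.bag_subset t v ht)
      rw [this, Set.image_empty, Set.empty_union]
      exact hg h2
    · exact absurd hv (by simp [h1, h2])
  · rintro (t | t)
    · exact hb t
    · exact hc t

/-- In a tree the nodes that separate `a` from `b` form a connected set. -/
theorem IsTree.connected_induce_separators {N : Type*} {T : SimpleGraph N} (hT : T.IsTree)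
    (a b : N) : (T.induce {t | ∀ p : T.Walk a b, t ∈ p.support}).Connected := by
  classical
  obtain ⟨p, hp, huniq⟩ := hT.existsUnique_path a b
  have : {t | ∀ p : T.Walk a b, t ∈ p.support} = {t | t ∈ p.support} := by
    ext t
    refine ⟨fun h => h p, fun h q => q.support_bypass_subset_support ?_⟩
    rw [huniq _ q.bypass_isPath]
    exact h
  rw [this]
  exact p.connected_induce_support

/-- A walk from outside `C` to `X`, where `X` contains the boundary of `C`, reaches `X` before it
enters `C`. -/
theorem Walk.exists_walk_avoiding {C X : Set V}
    (hC : ∀ u ∈ C, ∀ w, G.Adj u w → w ∈ C ∨ w ∈ X) {v x : V} (p : G.Walk v x) (hv : v ∉ C)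
    (hx : x ∈ X) :
    ∃ y ∈ X, ∃ q : G.Walk v y, ∀ u ∈ q.support, u ∈ p.support ∧ u ∉ C := by
  induction p with
  | nil => exact ⟨_, hx, .nil, fun u hu => ⟨hu, by simp_all⟩⟩
  | @cons v w z h p ih =>
    by_cases hvX : v ∈ X
    · exact ⟨v, hvX, .nil, by simp [hv]⟩
    · have hw : w ∉ C := fun hw => (hC w hw v h.symm).elim hv hvX
      obtain ⟨y, hy, q, hq⟩ := ih hw hx
      refine ⟨y, hy, .cons h q, fun u hu => ?_⟩
      rw [support_cons, List.mem_cons] at hu ⊢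
      rcases hu with rfl | hu
      · exact ⟨Or.inl rfl, hv⟩
      · exact ⟨Or.inr (hq u hu).1, (hq u hu).2⟩

/-! ### Admissible decompositions of `X ∪ C` -/

/-- A finite set of vertices is admissible for a family `B` if it has at most `k` elements or fails
to cover `B`. -/
def Admissible (k : ℕ) (B : Set (Set V)) (S : Finset V) : Prop :=
  k < S.card → ¬ IsBrambleCover B S

/-- The exchange argument at the heart of the proof. Restricting the bags to `X ∪ C` and adding `X`
to the bag of `s` requires carrying each `x ∈ X` along the tree path to `s`. As the bag of `s`
covers `B` and avoids `C`, minimality of the cover `X` shows that each bag gains at most as many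
vertices as it loses. -/
theorem TreeDecomposition.hasTreeDecompositionOn_of_bag_disjoint {k : ℕ} {B : Set (Set V)}
    (hB : G.IsBramble B) {X : Finset V} (hX : IsBrambleCover B X) (hXk : X.card ≤ k)
    (hmin : ∀ S, IsBrambleCover B S → X.card ≤ S.card) {C : Set V}
    (hC : ∀ u ∈ C, ∀ w, G.Adj u w → w ∈ C ∨ w ∈ (X : Set V))
    (D : G.TreeDecomposition) (hD : ∀ t, Admissible k (insert C B) (D.bag t)) {s : D.node}
    (hs : IsBrambleCover B (D.bag s)) (hsC : ∀ v ∈ D.bag s, v ∉ C) :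
    G.HasTreeDecompositionOn (Admissible k B) (X ∪ C) X := by
  classical
  choose r hr using D.exists_mem_bag
  let sep : D.node → V → Prop := fun t x => ∀ p : D.tree.Walk (r x) s, t ∈ p.support
  -- The second part carries `x` along the path from its chosen node `r x` to `s`.
  let W : D.node → Finset V := fun t =>
    (D.bag t).filter (· ∈ (X : Set V) ∪ C) ∪ X.filter (sep t)
  have hmemW : ∀ t v, v ∈ W t ↔ (v ∈ D.bag t ∧ (v ∈ X ∨ v ∈ C)) ∨ (v ∈ X ∧ sep t v) := by
    intro t v
    simp [W]
  -- a walk between a vertex of `X` and the bag of `s` meets all bags in between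
  have hmeet : ∀ t x v (p : G.Walk x v), v ∈ D.bag s → sep t x → ∃ u ∈ p.support, u ∈ D.bag t := by
    intro t x v p hv hsep
    obtain ⟨q, hq⟩ := D.exists_walk_of_walk p (hr x) hv
    exact hq t (hsep q)
  have hcard : ∀ t, (W t).card ≤ (D.bag t).card := by
    intro t
    let A : Finset V := X.filter fun x => sep t x ∧ x ∉ D.bag t
    let R : Finset V := (D.bag t).filter fun v => v ∉ (X : Set V) ∪ C
    -- `A` is what the bag of `t` gains and `R` what it loses. A walk inside `Z` from the bag of `s`
    -- can be stopped at some `y ∈ X` without entering `C`. If `y ∈ A`, that walk meets the bag of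
    -- `t`, in a vertex of `X \ A` or of `R`. Minimality of `X` then gives `A.card ≤ R.card`.
    have hcov : IsBrambleCover B (X \ A ∪ R) := by
      intro Z hZ
      obtain ⟨x, hxX, hxZ⟩ := hX Z hZ
      obtain ⟨v, hvs, hvZ⟩ := hs Z hZ
      obtain ⟨p, hp⟩ := (connected_induce_iff_exists_walk.1 (hB.1 Z hZ)).2 v hvZ x hxZ
      obtain ⟨y, hy, q, hq⟩ := p.exists_walk_avoiding hC (hsC v hvs) hxX
      by_cases hyA : y ∈ A
      · obtain ⟨u, hu, hut⟩ := hmeet t y v q.reverse hvs (Finset.mem_filter.1 hyA).2.1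
        obtain ⟨hup, huC⟩ := hq u (by simpa using hu)
        refine ⟨u, ?_, hp u hup⟩
        by_cases huX : u ∈ X
        · simp [A, huX, hut]
        · simp [R, huX, hut, huC]
      · exact ⟨y, by simp [hyA, Finset.mem_coe.1 hy], hp y (hq y q.end_mem_support).1⟩
    have h1 := hmin _ hcov
    have h2 := Finset.card_union_le (X \ A) R
    have h3 : (X \ A).card + A.card = X.card :=
      Finset.card_sdiff_add_card_eq_card (Finset.filter_subset _ X)
    have h4 := (D.bag t).card_filter_add_card_filter_not (· ∈ (X : Set V) ∪ C)
    have h5 : W t ⊆ (D.bag t).filter (· ∈ (X : Set V) ∪ C) ∪ A := by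
      intro v hv
      rw [hmemW] at hv
      simp only [A, Finset.mem_union, Finset.mem_filter, Set.mem_union, Finset.mem_coe]
      tauto
    have h6 := (Finset.card_le_card h5).trans (Finset.card_union_le _ _)
    change _ + R.card = _ at h4
    omega
  refine ⟨D.node, inferInstance, D.tree, W, ⟨D.isTree, ?_, ?_, ?_, ?_⟩, ?_, s, ?_⟩
  · intro t v hv
    rw [hmemW] at hv
    simp only [Set.mem_union, Finset.mem_coe]
    tauto
  · exact fun v hv => ⟨r v, (hmemW _ _).2 (Or.inl ⟨hr v, hv⟩)⟩
  · intro v hv w hw h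
    obtain ⟨t, hvt, hwt⟩ := D.exists_edge_bag v w h
    exact ⟨t, (hmemW _ _).2 (Or.inl ⟨hvt, hv⟩), (hmemW _ _).2 (Or.inl ⟨hwt, hw⟩)⟩
  · intro v hv
    by_cases hvX : v ∈ X
    · have : {t | v ∈ W t} = {t | v ∈ D.bag t} ∪ {t | sep t v} := by
        ext t
        simp [hmemW, hvX]
      rw [this]
      exact induce_union_connected (D.connected_nodes v).preconnected
        (D.isTree.connected_induce_separators _ _).preconnected
        ⟨r v, hr v, fun p => p.start_mem_support⟩
    · have hvC : v ∈ C := hv.resolve_left hvX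
      have : {t | v ∈ W t} = {t | v ∈ D.bag t} := by
        ext t
        simp [hmemW, hvX, hvC]
      rw [this]
      exact D.connected_nodes v
  -- A large `W t` comes from a large bag, which misses some `Z` in `insert C B`. If `Z = C`, then
  -- `W t ⊆ X` is small. If `Z ∈ B`, then `W t` can meet `Z` only in a carried vertex, and a walk
  -- inside `Z` from there to the bag of `s` would meet the bag of `t`.
  · intro t hk hcov
    have hV := hD t (hk.trans_le (hcard t))
    simp only [IsBrambleCover, not_forall, not_exists, not_and] at hV
    obtain ⟨Z, hZ, hZt⟩ := hV
    rcases hZ with rfl | hZ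
    · have : W t ⊆ X := by
        intro v hv
        rw [hmemW] at hv
        have := hZt v
        tauto
      exact absurd (Finset.card_le_card this) (by omega)
    · obtain ⟨u, huW, huZ⟩ := hcov Z hZ
      obtain ⟨v, hvs, hvZ⟩ := hs Z hZ
      obtain ⟨p, hp⟩ := (connected_induce_iff_exists_walk.1 (hB.1 Z hZ)).2 u huZ v hvZ
      have hsep : sep t u := by
        rcases (hmemW t u).1 huW with h | h
        · exact absurd huZ (hZt u h.1)
        · exact h.2
      obtain ⟨w, hw, hwt⟩ := hmeet t u v p hvs hsep
      exact hZt w hwt (hp w hw)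
  · exact fun x hx => (hmemW _ _).2 (Or.inr ⟨hx, fun p => p.end_mem_support⟩)

theorem Touch.symm {X Y : Set V} (h : G.Touch X Y) : G.Touch Y X := by
  rcases h with ⟨v, hX, hY⟩ | ⟨x, hx, y, hy, h⟩
  · exact Or.inl ⟨v, hY, hX⟩
  · exact Or.inr ⟨y, hy, x, hx, h.symm⟩

/-- The part of a decomposition on `X ∪ C`, for a set `C` that does not touch some element
of `B`. -/
theorem hasTreeDecompositionOn_of_not_touch [Finite V] {k : ℕ} {B : Set (Set V)} {X : Finset V}
    (hXk : X.card ≤ k) {C : Set V} {Y : Set V} (hY : Y ∈ B) (hCY : ¬ G.Touch C Y) :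
    G.HasTreeDecompositionOn (Admissible k B) (X ∪ C) X := by
  classical
  have := Fintype.ofFinite V
  -- `C` with its neighbours in `X`. This bag misses `Y`, since `C` does not touch `Y`, and `X`
  -- itself serves as the other bag.
  let S : Finset V := Finset.univ.filter fun v => v ∈ C ∨ (v ∈ X ∧ ∃ u ∈ C, G.Adj u v)
  have hS : ∀ v, v ∈ S ↔ v ∈ C ∨ (v ∈ X ∧ ∃ u ∈ C, G.Adj u v) := by simp [S]
  have hSQ : Admissible k B S := by
    intro _ hcov
    obtain ⟨v, hvS, hvY⟩ := hcov Y hY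
    rcases (hS v).1 hvS with h | ⟨-, u, hu, h⟩
    · exact hCY (Or.inl ⟨v, h, hvY⟩)
    · exact hCY (Or.inr ⟨u, hu, v, hvY, h⟩)
  have hXQ : Admissible k B X := fun h => absurd hXk (by omega)
  have key := (HasTreeDecompositionOn.of_bag (G := G) hXQ).union (.of_bag hSQ)
    Set.inter_subset_left Set.inter_subset_right ?_
  · have heq : (X : Set V) ∪ S = (X : Set V) ∪ C := by
      ext v
      simp only [Set.mem_union, Finset.mem_coe, hS]
      tauto
    rwa [heq] at key
  · intro v hv w hw h
    rcases (hS w).1 hw with hw | hw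
    · exact Or.inl ((hS v).2 (Or.inr ⟨hv, w, hw, h.symm⟩))
    · exact Or.inr hw.1

/-! ### Components of `G - X` -/

/-- The vertices that can be reached from `v` in `G - X`. -/
def componentAvoiding (G : SimpleGraph V) (X : Set V) (v : V) : Set V :=
  {w | ∃ p : G.Walk v w, ∀ u ∈ p.support, u ∉ X}

theorem connected_componentAvoiding {X : Set V} {v : V} (hv : v ∉ X) :
    (G.induce (G.componentAvoiding X v)).Connected := by
  classical
  have hsub : ∀ {w} (p : G.Walk v w), (∀ u ∈ p.support, u ∉ X) →
      ∀ u ∈ p.support, u ∈ G.componentAvoiding X v := fun p hp u hu =>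
    ⟨p.takeUntil u hu, fun z hz => hp z (p.support_takeUntil_subset_support hu hz)⟩
  refine connected_induce_iff_exists_walk.2 ⟨⟨v, .nil, by simpa using hv⟩, ?_⟩
  rintro a ⟨p, hp⟩ b ⟨q, hq⟩
  refine ⟨p.reverse.append q, fun u hu => ?_⟩
  rcases (Walk.mem_support_append_iff _ _).1 hu with hu | hu
  · exact hsub p hp u (by simpa using hu)
  · exact hsub q hq u hu

theorem notMem_of_mem_componentAvoiding {X : Set V} {v w : V}
    (hw : w ∈ G.componentAvoiding X v) : w ∉ X := by
  obtain ⟨p, hp⟩ := hw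
  exact hp w p.end_mem_support

theorem mem_componentAvoiding_or_mem_of_adj {X : Set V} {v : V} :
    ∀ u ∈ G.componentAvoiding X v, ∀ w, G.Adj u w → w ∈ G.componentAvoiding X v ∨ w ∈ X := by
  rintro u ⟨p, hp⟩ w h
  refine or_iff_not_imp_right.2 fun hw => ⟨p.concat h, fun z hz => ?_⟩
  rw [Walk.support_concat, List.mem_append, List.mem_singleton] at hz
  rcases hz with hz | rfl
  · exact hp z hz
  · exact hw

/-- Decompositions of the parts of `G` attached to `X` combine to one of `G`. -/
theorem HasTreeDecompositionOn.univ_of_components [Finite V] {Q : Finset V → Prop} {X : Finset V}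
    (hX : Q X)
    (h : ∀ v ∉ X, G.HasTreeDecompositionOn Q (X ∪ G.componentAvoiding X v) X) :
    G.HasTreeDecompositionOn Q Set.univ X := by
  -- Choose a maximal decomposable union of `X` with components of `G - X`; a vertex outside it
  -- would allow one more component to be glued on.
  obtain ⟨U, hU⟩ := (Set.toFinite {U : Set V | (X : Set V) ⊆ U ∧
    (∀ u ∈ U, u ∉ X → ∀ w, G.Adj u w → w ∈ U) ∧
      G.HasTreeDecompositionOn Q U X}).exists_maximal
        ⟨X, subset_rfl, fun u hu hu' => absurd hu hu', .of_bag hX⟩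
  obtain ⟨⟨hXU, hUadj, hUdec⟩, hmax⟩ := hU
  suffices hUuniv : U = Set.univ by rwa [← hUuniv]
  by_contra hne
  obtain ⟨v, hvU⟩ := (Set.ne_univ_iff_exists_notMem U).1 hne
  have hvX : v ∉ X := fun hv => hvU (hXU hv)
  set C := G.componentAvoiding X v with hCdef
  have hvC : v ∈ C := ⟨.nil, by simpa using hvX⟩
  have hCU : ∀ w ∈ C, w ∉ U := by
    rintro w ⟨p, hp⟩
    clear * - p hp hvU hUadj
    induction p with
    | nil => exact hvU
    | @cons a b c hab p ih =>
      have hb := hp b (by simp)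
      exact ih (fun hbU => hvU (hUadj b hbU hb a hab.symm)) fun u hu => hp u (by simp [hu])
  have hinter : U ∩ (X ∪ C) ⊆ X := fun w hw =>
    hw.2.resolve_right fun hwC => hCU w hwC hw.1
  refine hvU (hmax ⟨hXU.trans Set.subset_union_left, ?_, hUdec.union (h v hvX) hinter hinter ?_⟩
    (Set.subset_union_left (t := (X ∪ C : Set V))) (Or.inr (Or.inr hvC)))
  · rintro u (hu | hu | hu) huX w huw
    · exact Or.inl (hUadj u hu huX w huw)
    · exact absurd hu huX
    · exact Or.inr (mem_componentAvoiding_or_mem_of_adj u hu w huw).symm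
  · rintro u hu w (hw | hw) huw
    · exact Or.inr (hXU hw)
    · exact Or.inl (mem_componentAvoiding_or_mem_of_adj w hw u huw.symm).symm

theorem IsBramble.insert_of_touch {B : Set (Set V)} (hB : G.IsBramble B) {C : Set V}
    (hC : (G.induce C).Connected) (h : ∀ Y ∈ B, G.Touch C Y) : G.IsBramble (insert C B) := by
  refine ⟨?_, ?_⟩
  · rintro Z (rfl | hZ)
    · exact hC
    · exact hB.1 Z hZ
  · rintro Y (rfl | hY) Z (rfl | hZ)
    · obtain ⟨v⟩ := hC.nonempty
      exact Or.inl ⟨v, v.2, v.2⟩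
    · exact h Z hZ
    · exact (h Y hY).symm
    · exact hB.2 Y hY Z hZ

theorem HasTreeDecompositionOn.exists_treeDecomposition {Q : Finset V → Prop} {X : Set V}
    (h : G.HasTreeDecompositionOn Q Set.univ X) :
    ∃ D : G.TreeDecomposition, ∀ t, Q (D.bag t) := by
  obtain ⟨N, _, T, bag, hT, hQ, -⟩ := h
  exact ⟨⟨N, Fintype.ofFinite N, T, hT.isTree, bag, fun v => hT.exists_mem_bag v trivial,
    fun v w => hT.exists_edge_bag v trivial w trivial, fun v => hT.connected_nodes v trivial⟩, hQ⟩

/-! ### Induction on brambles and the duality -/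

/-- If every bramble has a cover of size at most `k`, then every bramble has a tree-decomposition
in which no bag of size more than `k` covers it. -/
theorem IsBramble.exists_admissible_treeDecomposition [Finite V] {k : ℕ}
    (hk : ∀ B, G.IsBramble B → ∃ S, IsBrambleCover B S ∧ S.card ≤ k) {B : Set (Set V)}
    (hB : G.IsBramble B) : ∃ D : G.TreeDecomposition, ∀ t, Admissible k B (D.bag t) := by
  induction B using WellFoundedGT.induction with
  | ind B ih =>
    obtain ⟨S, hS, hSk⟩ := hk B hB
    obtain ⟨⟨X, hX, hXcard⟩, hmin⟩ := hB.isLeast_order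
    replace hmin : ∀ S, IsBrambleCover B S → X.card ≤ S.card := fun S hS =>
      hXcard ▸ hmin ⟨S, hS, rfl⟩
    have hXk : X.card ≤ k := (hmin S hS).trans hSk
    -- Assuming that `B` has no admissible decomposition, every decomposition obtained for a larger
    -- bramble has a bag of more than `k` vertices covering `B`.
    by_contra hno
    refine hno (HasTreeDecompositionOn.exists_treeDecomposition (X := X)
      (.univ_of_components (fun h => absurd hXk (by omega)) fun v hv => ?_))
    have hCadj := mem_componentAvoiding_or_mem_of_adj (G := G) (X := X) (v := v)
    have hCconn := connected_componentAvoiding (G := G) (X := X) (v := v) hv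
    have hCX : ∀ w ∈ G.componentAvoiding X v, w ∉ (X : Set V) :=
      fun w => notMem_of_mem_componentAvoiding
    generalize G.componentAvoiding X v = C at *
    by_cases htouch : ∀ Y ∈ B, G.Touch C Y
    · have hCB : C ∉ B := fun hCB => by
        obtain ⟨w, hwX, hwC⟩ := hX C hCB
        exact hCX w hwC hwX
      obtain ⟨D, hD⟩ := ih (insert C B) (Set.ssubset_insert hCB) (hB.insert_of_touch hCconn htouch)
      have hD' : ∃ s, ¬ Admissible k B (D.bag s) := by
        by_contra! h
        exact hno ⟨D, h⟩
      obtain ⟨s, hs⟩ := hD'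
      simp only [Admissible, not_forall, not_not] at hs
      obtain ⟨hsk, hsB⟩ := hs
      -- The bag of `s` covers `B` and is too large to cover `insert C B` as well, so it is disjoint
      -- from `C`.
      refine D.hasTreeDecompositionOn_of_bag_disjoint hB hX hXk hmin hCadj hD hsB
        fun w hw hwC => hD s hsk ?_
      rintro Z (rfl | hZ)
      · exact ⟨w, hw, hwC⟩
      · exact hsB Z hZ
    · push Not at htouch
      obtain ⟨Y, hY, hCY⟩ := htouch
      exact hasTreeDecompositionOn_of_not_touch hXk hY hCY

theorem IsBramble.order_le_treewidth [Finite V] {B : Set (Set V)} (hB : G.IsBramble B) :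
    (brambleOrder B : ℤ) ≤ G.treewidth + 1 := by
  obtain ⟨D, hD⟩ := G.isLeast_treewidth.1
  obtain ⟨t, ht⟩ := D.exists_bag_isBrambleCover hB
  have h1 := hB.isLeast_order.2 ⟨D.bag t, ht, rfl⟩
  have h2 := Finset.le_sup (f := fun t => (D.bag t).card) (Finset.mem_univ t)
  simp only [TreeDecomposition.width] at hD
  omega

theorem exists_bramble_of_le_treewidth [Finite V] {k : ℕ} (hk : (k : ℤ) ≤ G.treewidth) :
    ∃ B, G.IsBramble B ∧ k < brambleOrder B := by
  by_contra! hno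
  -- Every set covers the empty bramble, so admissibility for it bounds all bags by `k`.
  obtain ⟨D, hD⟩ := IsBramble.exists_admissible_treeDecomposition (G := G) (k := k) (B := ∅)
    (fun B hB => by
      obtain ⟨S, hS, hSc⟩ := hB.isLeast_order.1
      exact ⟨S, hS, hSc ▸ hno B hB⟩) ⟨by simp, by simp⟩
  have hle : (Finset.univ.sup fun t => (D.bag t).card) ≤ k :=
    Finset.sup_le fun t _ => not_lt.1 fun h => hD t h (by simp [IsBrambleCover])
  have := G.isLeast_treewidth.2 ⟨D, rfl⟩
  simp only [TreeDecomposition.width] at this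
  omega

end SimpleGraph

theorem mainTheorem1 {V : Type u} [Finite V] (G : SimpleGraph V) :
    (∀ k : ℕ, (k : ℤ) ≤ G.treewidth ↔ ∃ B : Set (Set V), G.IsBramble B ∧ k < brambleOrder B) ∧
      IsGreatest {n : ℤ | ∃ B : Set (Set V), G.IsBramble B ∧ (brambleOrder B : ℤ) = n}
        (G.treewidth + 1) := by
  refine ⟨fun k => ⟨SimpleGraph.exists_bramble_of_le_treewidth, ?_⟩, ?_, ?_⟩
  · rintro ⟨B, hB, hk⟩
    have := hB.order_le_treewidth
    omega
  -- If the tree-width is negative, the empty bramble attains the maximum: its order is at least `0`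
  -- and at most `G.treewidth + 1 ≤ 0`.
  · rcases lt_or_ge G.treewidth 0 with h | h
    · have hB : G.IsBramble ∅ := ⟨by simp, by simp⟩
      have := hB.order_le_treewidth
      exact ⟨∅, hB, by omega⟩
    · obtain ⟨k, hk⟩ := Int.eq_ofNat_of_zero_le h
      obtain ⟨B, hB, hkB⟩ := SimpleGraph.exists_bramble_of_le_treewidth hk.ge
      have := hB.order_le_treewidth
      exact ⟨B, hB, by omega⟩
  · rintro _ ⟨B, hB, rfl⟩
    exact hB.order_le_treewidth
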